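/- In the $\textsc{eq-idx}_{p,q}$ problem Alice holds strings $x_1,\dots,x_p\in\{0,1\}^q$, Bob holds $y\in\{0,1\}^q$ and $j\in[p]$, and the value is $1$ if $y=x_j$ and $0$ otherwise. For a Boolean function $f(x,y)$, with $x$ held by Alice and $y$ by Bob, let $R^{\to}(f)$ be its randomized one-way communication complexity: the minimum, over private-coin protocols in which Alice sends Bob a single message from which (together with his input) he outputs $f(x,y)$ with error probability at most $1/3$ on every input, of the maximum length of Alice's message. In an online Merlin-Arthur (OMA) protocol $\Pi$, Merlin, who knows $x$ and $y$, sends Bob a bit string $\mathcal H$; then a random string $\mathcal R$ is drawn, and Alice sends Bob a bit string that depends on $x$ and $\mathcal R$; Bob outputs an element of $\{0,1,\bot\}$ depending on $y$, $\mathcal H$, Alice's message and $\mathcal R$. The protocol solves $f$ if, whenever $f(x,y)=1$, the prescribed message of Merlin makes Bob output $1$ with probability at least $2/3$, and, whenever $f(x,y)=0$, Bob outputs $1$ with probability at most $1/3$ for every string $\mathcal H'$ that Merlin might send. Let $\textsf{hcost}(\Pi)$ and $\textsf{vcost}(\Pi)$ be the maximum lengths of Merlin's prescribed message and of Alice's message,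 and let $\textsf{tcost}(\Pi)=\textsf{hcost}(\Pi)+\textsf{vcost}(\Pi)$. For a family of functions $f=(f_N)_N$, a family of OMA protocols $\Pi=(\Pi_N)_N$ solving it is non-trivial if $\textsf{vcost}(\Pi_N)=o(R^{\to}(f_N))$ as $N\to\infty$. The non-trivial OMA complexity $\widehat{\mathrm{MA}}^{\to}(f)$ is the minimum of $\textsf{tcost}$ over the non-trivial protocols for $f$; that it is $\omega(g)$ means that non-trivial protocols for $f$ exist and that each of them satisfies $\textsf{tcost}(\Pi_N)=\omega(g(N))$. Corollary. Let $C=C(N)$ be any real-valued function with $\sqrt N\le C(N)\le N/\log_2 N$ for all sufficiently large $N$. Put $p=\lfloor N/C\rfloor$ and $q=\lfloor C\rfloor$, so that Alice's input to $f_N=\textsc{eq-idx}_{p,q}$ has $pq\le N$ bits and $pq=(1-o(1))N$. Then $\widehat{\mathrm{MA}}^{\to}(f)=\omega(C)$. In particular (taking $C=N/\log_2 N$) the non-trivial OMA complexity of an explicit function on input size $N$ can be $\omega(N/\log N)$. -/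

import Mathlib

open Filter Asymptotics

/-- The probability, over `r` independent fair coin tosses, of the event `E`. -/
noncomputable def coinProb (r : ℕ) (E : (Fin r → Bool) → Prop) : ℝ :=
  (Nat.card {R : Fin r → Bool // E R} : ℝ) / 2 ^ r

/-- A one-way (Alice to Bob) private-coin protocol: Alice tosses `coins` fair coins and sends Bob
a bit string depending on her input and her coins; Bob outputs a bit that depends only on his
input and the message. -/
structure OneWayProtocol (X Y : Type) where
  coins : ℕ
  msg : X → (Fin coins → Bool) → List Bool
  out : Y → List Bool → Bool

namespace OneWayProtocol

variable {X Y : Type}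

/-- The protocol computes `f` with error at most `1/3` on every input. -/
def Solves (P : OneWayProtocol X Y) (f : X → Y → Bool) : Prop :=
  ∀ x y, coinProb P.coins (fun R => P.out y (P.msg x R) ≠ f x y) ≤ 1 / 3

/-- Maximum length of Alice's message over all inputs and coin tosses. -/
def cost [Fintype X] (P : OneWayProtocol X Y) : ℕ :=
  Finset.univ.sup fun z : X × (Fin P.coins → Bool) => (P.msg z.1 z.2).length

end OneWayProtocol

/-- The private-coin randomized one-way communication complexity of `f`. -/
noncomputable def oneWayComplexity {X Y : Type} [Fintype X] (f : X → Y → Bool) : ℕ :=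
  sInf {c : ℕ | ∃ P : OneWayProtocol X Y, P.Solves f ∧ P.cost = c}

/-- The minimum in the definition of the one-way complexity is attained. -/
theorem exists_cost_eq_oneWayComplexity {X Y : Type} [Fintype X] (f : X → Y → Bool) :
    ∃ P : OneWayProtocol X Y, P.Solves f ∧ P.cost = oneWayComplexity f := by
  classical
  apply Nat.sInf_mem (s := {c : ℕ | ∃ P : OneWayProtocol X Y, P.Solves f ∧ P.cost = c})
  let e := Fintype.equivFin X
  let P : OneWayProtocol X Y :=
    { coins := 0
      msg := fun x _ => List.replicate (e x) true
      out := fun y m => if h : m.length < Fintype.card X then f (e.symm ⟨m.length, h⟩) y else false }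
  refine ⟨P.cost, P, ?_, rfl⟩
  intro x y
  have h : ∀ R, P.out y (P.msg x R) = f x y := by
    intro R
    simp [P]
  simp [coinProb, h]

/-- An online Merlin-Arthur protocol. Merlin, who knows both inputs, sends Bob the bit string
`help x y`. Then (so independently of Merlin's message) the random string, consisting of `coins`
fair coin tosses, is drawn, and Alice sends Bob the bit string `msg x R`. Bob outputs `some true`
(for 1), `some false` (for 0) or `none` (rejection) depending on his input, Merlin's message,
Alice's message and the random string. -/
structure OMAProtocol (X Y : Type) where
  coins : ℕ
  help : X → Y → List Bool
  msg : X → (Fin coins → Bool) → List Bool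
  out : Y → List Bool → List Bool → (Fin coins → Bool) → Option Bool

namespace OMAProtocol

variable {X Y : Type}

/-- The protocol computes `f` with completeness error and soundness error at most `1/3`. -/
def Solves (P : OMAProtocol X Y) (f : X → Y → Bool) : Prop :=
  (∀ x y, f x y = true →
    coinProb P.coins (fun R => P.out y (P.help x y) (P.msg x R) R ≠ some true) ≤ 1 / 3) ∧
  (∀ x y, f x y = false → ∀ H : List Bool,
    coinProb P.coins (fun R => P.out y H (P.msg x R) R = some true) ≤ 1 / 3)

/-- Help cost: the maximum length of Merlin's message. -/
def hcost [Fintype X] [Fintype Y] (P : OMAProtocol X Y) : ℕ :=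
  Finset.univ.sup fun z : X × Y => (P.help z.1 z.2).length

/-- Verification cost: the maximum length of Alice's message. -/
def vcost [Fintype X] (P : OMAProtocol X Y) : ℕ :=
  Finset.univ.sup fun z : X × (Fin P.coins → Bool) => (P.msg z.1 z.2).length

/-- Total cost. -/
def tcost [Fintype X] [Fintype Y] (P : OMAProtocol X Y) : ℕ :=
  P.hcost + P.vcost

end OMAProtocol

section Families

variable {X Y : ℕ → Type} [∀ N, Fintype (X N)]

/-- `P` is a non-trivial protocol for the family of functions `f` (indexed by the input size):
it solves `f` and its verification cost is `o(R)`, where `R` is the one-way complexity of `f`. -/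
def IsNontrivialOMA (f : ∀ N, X N → Y N → Bool) (P : ∀ N, OMAProtocol (X N) (Y N)) : Prop :=
  (∀ N, (P N).Solves (f N)) ∧
  (fun N => ((P N).vcost : ℝ)) =o[atTop] (fun N => (oneWayComplexity (f N) : ℝ))

/-- The non-trivial OMA complexity of the family `f`, i.e. the minimum total cost of a non-trivial
protocol for `f`, is `ω(g)`. As being non-trivial is an asymptotic condition, the minimum ranges
over families of protocols: there are non-trivial protocols for `f`, and each of them has total
cost `ω(g)`. -/
def NontrivialOMAComplexityIsOmega [∀ N, Fintype (Y N)] (f : ∀ N, X N → Y N → Bool)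
    (g : ℕ → ℝ) : Prop :=
  (∃ P : ∀ N, OMAProtocol (X N) (Y N), IsNontrivialOMA f P) ∧
  ∀ P : ∀ N, OMAProtocol (X N) (Y N), IsNontrivialOMA f P →
    g =o[atTop] (fun N => ((P N).tcost : ℝ))

end Families

/-- The Equals-Index problem: Alice holds `p` strings of `q` bits, Bob holds a string `y` of `q`
bits and an index `j`, and the output is 1 if and only if `y` is Alice's `j`-th string. -/
def eqIdx (p q : ℕ) (x : Fin p → Fin q → Bool) (yj : (Fin q → Bool) × Fin p) : Bool :=
  decide (yj.1 = x yj.2)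

/-! The corollary rests on a trade-off for any OMA protocol with help cost `h` and verification cost
`v`: `p * q = O((h + q) * v)` (`eqIdx_le_of_solves`). Repeating Alice's message `O(h + q)` times
makes the error so small that Bob can try every help string himself and, for at least half of the
random strings, be right on all his `2 ^ q * p` inputs at once. A random string that is good for
half of Alice's inputs then turns her messages into an injective encoding of those inputs.

On the other side, one-way protocols are cheap: hashing each string to two bits gives `R = O(p)`,
provided the `O(log q)` bits of seed are absorbed by `p` (`oneWayComplexity_eqIdx_le`). So
non-trivial means `v = o(p)`, and the trade-off forces `h = ω(q)`, where `q ~ C`. Non-trivial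
protocols exist since two bits of verification suffice (`exists_solves_vcost_le_two`), while the
trade-off with `h = 0` shows that `R` is unbounded. -/

theorem coinProb_eq_card_filter {r : ℕ} (E : (Fin r → Bool) → Prop) [DecidablePred E] :
    coinProb r E = ((Finset.univ.filter E).card : ℝ) / 2 ^ r := by
  rw [coinProb, Nat.card_eq_fintype_card, Fintype.card_subtype]

theorem coinProb_le_third_iff {r : ℕ} (E : (Fin r → Bool) → Prop) [DecidablePred E] :
    coinProb r E ≤ 1 / 3 ↔ 3 * (Finset.univ.filter E).card ≤ 2 ^ r := by
  rw [coinProb_eq_card_filter, div_le_div_iff₀ (by positivity) (by norm_num)]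
  constructor
  · intro h
    have : ((3 * (Finset.univ.filter E).card : ℕ) : ℝ) ≤ ((2 ^ r : ℕ) : ℝ) := by
      push_cast; linarith
    exact_mod_cast this
  · intro h
    have : ((3 * (Finset.univ.filter E).card : ℕ) : ℝ) ≤ ((2 ^ r : ℕ) : ℝ) := by
      exact_mod_cast h
    push_cast at this; linarith

/-- A uniform seed from a set of `2 ^ r` elements can be drawn with `r` coins. -/
theorem coinProb_comp_equiv_le_third {r : ℕ} {S : Type*} [Fintype S] (e : (Fin r → Bool) ≃ S)
    (E : S → Prop) [DecidablePred E]
    (h : 3 * (Finset.univ.filter E).card ≤ Fintype.card S) :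
    coinProb r (fun R => E (e R)) ≤ 1 / 3 := by
  classical
  rw [coinProb_le_third_iff]
  have h1 : (Finset.univ.filter fun R => E (e R)).card = (Finset.univ.filter E).card := by
    rw [← Fintype.card_subtype, ← Fintype.card_subtype]
    exact Fintype.card_congr (e.subtypeEquiv fun _ => Iff.rfl)
  have h2 : Fintype.card S = 2 ^ r := by
    rw [← Fintype.card_congr e]; simp
  rw [h1, ← h2]; exact h

/-! ### Amplification and the removal of Merlin. -/

/-- Exponential tail bound for the number of hits of a set of density at most `1/3` in `2 * l`
independent uniform trials. -/
theorem card_half_hits_le {Ω : Type*} [Fintype Ω] [DecidableEq Ω] (S : Finset Ω)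
    (hS : 3 * S.card ≤ Fintype.card Ω) (l : ℕ) :
    9 ^ l * (Finset.univ.filter fun w : Fin (2 * l) → Ω =>
      l ≤ (Finset.univ.filter fun i => w i ∈ S).card).card ≤ 8 ^ l * Fintype.card Ω ^ (2 * l) := by
  set A := Finset.univ.filter fun w : Fin (2 * l) → Ω =>
      l ≤ (Finset.univ.filter fun i => w i ∈ S).card with hA
  -- Markov's inequality for `2 ^ hits`: its mean is at most `(4/3) ^ (2 * l)`, and dividing by `2 ^
  -- l` leaves `(8/9) ^ l`.
  have h1 : ∑ w : Fin (2 * l) → Ω, ∏ i, (if w i ∈ S then 2 else 1) =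
      (Fintype.card Ω + S.card) ^ (2 * l) := by
    rw [← Fintype.sum_pow (fun a : Ω => if a ∈ S then 2 else 1)]
    congr 1
    have : ∀ a : Ω, (if a ∈ S then 2 else 1) = 1 + if a ∈ S then 1 else 0 := by
      intro a; split_ifs <;> rfl
    simp [this, Finset.sum_add_distrib]
  have h2 : A.card * 2 ^ l ≤ (Fintype.card Ω + S.card) ^ (2 * l) := by
    rw [← h1, ← smul_eq_mul]
    refine (Finset.card_nsmul_le_sum A _ _ ?_).trans
      (Finset.sum_le_sum_of_subset (Finset.subset_univ A))
    intro w hw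
    rw [Finset.prod_ite, Finset.prod_const, Finset.prod_const_one, mul_one]
    exact Nat.pow_le_pow_right (by norm_num) (Finset.mem_filter.1 hw).2
  have h3 : 3 ^ (2 * l) * (Fintype.card Ω + S.card) ^ (2 * l) ≤
      4 ^ (2 * l) * Fintype.card Ω ^ (2 * l) := by
    rw [← mul_pow, ← mul_pow]
    exact Nat.pow_le_pow_left (by omega) _
  have h4 : 2 ^ l * (9 ^ l * A.card) ≤ 2 ^ l * (8 ^ l * Fintype.card Ω ^ (2 * l)) := by
    calc 2 ^ l * (9 ^ l * A.card) = 3 ^ (2 * l) * (A.card * 2 ^ l) := by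
          rw [pow_mul 3]; ring
      _ ≤ _ := Nat.mul_le_mul_left _ h2
      _ ≤ _ := h3
      _ = _ := by
          rw [pow_mul 4, ← mul_assoc, ← mul_pow]; norm_num
  exact Nat.le_of_mul_le_mul_left h4 (by positivity)

/-- The bit strings of length at most `n`. -/
def boundedBitStrings (n : ℕ) : Finset (List Bool) :=
  (Finset.range (n + 1)).biUnion fun k => Finset.univ.image fun a : Fin k → Bool => List.ofFn a

theorem mem_boundedBitStrings {n : ℕ} {l : List Bool} (h : l.length ≤ n) :
    l ∈ boundedBitStrings n := by
  refine Finset.mem_biUnion.2 ⟨l.length, Finset.mem_range.2 (by omega), ?_⟩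
  exact Finset.mem_image.2 ⟨l.get, Finset.mem_univ _, List.ofFn_get l⟩

theorem card_boundedBitStrings_le (n : ℕ) : (boundedBitStrings n).card ≤ 2 ^ (n + 1) := by
  refine Finset.card_biUnion_le.trans ?_
  refine (Finset.sum_le_sum (g := fun k => 2 ^ k) fun k _ => ?_).trans ?_
  · exact Finset.card_image_le.trans (by simp)
  · rw [Nat.geomSum_eq le_rfl]; simp

namespace OMAProtocol

variable {X Y : Type} [Fintype X]

theorem length_msg_le (P : OMAProtocol X Y) (x : X) (R : Fin P.coins → Bool) :
    (P.msg x R).length ≤ P.vcost :=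
  Finset.le_sup (f := fun z : X × (Fin P.coins → Bool) => (P.msg z.1 z.2).length)
    (Finset.mem_univ (x, R))

theorem length_help_le [Fintype Y] (P : OMAProtocol X Y) (x : X) (y : Y) :
    (P.help x y).length ≤ P.hcost :=
  Finset.le_sup (f := fun z : X × Y => (P.help z.1 z.2).length) (Finset.mem_univ (x, y))

/-- Bob's decision from `2 * l` independent runs: accept if some help string of length at most the
help cost makes more than half of the runs accept. -/
def amplifiedAccepts [Fintype Y] (P : OMAProtocol X Y) (l : ℕ)
    (w : Fin (2 * l) → Fin P.coins → Bool) (y : Y) (m : Fin (2 * l) → List Bool) : Prop :=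
  ∃ H ∈ boundedBitStrings P.hcost,
    l < (Finset.univ.filter fun i => P.out y H (m i) (w i) = some true).card

/-- Each input is answered wrongly on few random strings of the amplified protocol. -/
theorem card_amplified_error_le [Fintype Y] {P : OMAProtocol X Y} {f : X → Y → Bool}
    (hP : P.Solves f) (l : ℕ) (x : X) (y : Y) (B : Finset (Fin (2 * l) → Fin P.coins → Bool))
    (hB : ∀ w ∈ B, ¬ (P.amplifiedAccepts l w y (fun i => P.msg x (w i)) ↔ f x y = true)) :
    9 ^ l * B.card ≤ 2 ^ (P.hcost + 1) * (8 ^ l * (2 ^ P.coins) ^ (2 * l)) := by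
  classical
  have hcard : Fintype.card (Fin P.coins → Bool) = 2 ^ P.coins := by simp
  cases hf : f x y with
  | true =>
    set S := Finset.univ.filter fun R => P.out y (P.help x y) (P.msg x R) R ≠ some true with hS
    have h3 : 3 * S.card ≤ Fintype.card (Fin P.coins → Bool) := by
      rw [hcard]; exact (coinProb_le_third_iff _).1 (hP.1 x y hf)
    have h4 := card_half_hits_le S h3 l
    rw [hcard] at h4
    refine (Nat.mul_le_mul_left _ (Finset.card_le_card ?_)).trans
      (h4.trans (Nat.le_mul_of_pos_left _ (by positivity)))
    intro w hw
    have hw' := hB w hw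
    simp only [hf, iff_true] at hw'
    refine Finset.mem_filter.2 ⟨Finset.mem_univ _, ?_⟩
    by_contra hlt
    apply hw'
    refine ⟨P.help x y, mem_boundedBitStrings (P.length_help_le x y), ?_⟩
    beta_reduce
    have := Finset.card_filter_add_card_filter_not (s := (Finset.univ : Finset (Fin (2 * l))))
      (fun i => P.out y (P.help x y) (P.msg x (w i)) (w i) = some true)
    simp only [hS, Finset.mem_filter, Finset.mem_univ, true_and, Finset.card_univ,
      Fintype.card_fin, ne_eq] at this hlt
    omega
  | false =>
    set S : List Bool → Finset (Fin P.coins → Bool) := fun H =>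
      Finset.univ.filter fun R => P.out y H (P.msg x R) R = some true with hS
    have h4 : ∀ H, 9 ^ l * (Finset.univ.filter fun w : Fin (2 * l) → Fin P.coins → Bool =>
        l ≤ (Finset.univ.filter fun i => w i ∈ S H).card).card ≤
        8 ^ l * (2 ^ P.coins) ^ (2 * l) := by
      intro H
      rw [← hcard]
      refine card_half_hits_le (S H) ?_ l
      rw [hcard]; exact (coinProb_le_third_iff _).1 (hP.2 x y hf H)
    -- The help string that fools Bob may depend on `w`; since soundness holds for each fixed `H`, a
    -- union bound over all `H` covers this.
    have hsub : B ⊆ (boundedBitStrings P.hcost).biUnion fun H =>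
        (Finset.univ.filter fun w : Fin (2 * l) → Fin P.coins → Bool =>
          l ≤ (Finset.univ.filter fun i => w i ∈ S H).card) := by
      intro w hw
      have hw' := hB w hw
      simp only [hf, Bool.false_eq_true, iff_false, not_not] at hw'
      obtain ⟨H, hH, hlt⟩ := hw'
      refine Finset.mem_biUnion.2 ⟨H, hH, Finset.mem_filter.2 ⟨Finset.mem_univ _, ?_⟩⟩
      simpa [hS] using hlt.le
    calc 9 ^ l * B.card ≤ 9 ^ l * ∑ H ∈ boundedBitStrings P.hcost, _ :=
          Nat.mul_le_mul_left _ ((Finset.card_le_card hsub).trans Finset.card_biUnion_le)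
      _ = ∑ H ∈ boundedBitStrings P.hcost, _ := Finset.mul_sum _ _ _
      _ ≤ (boundedBitStrings P.hcost).card • _ := Finset.sum_le_card_nsmul _ _ _ fun H _ => h4 H
      _ ≤ _ := by
          rw [smul_eq_mul]; exact Nat.mul_le_mul_right _ (card_boundedBitStrings_le _)

end OMAProtocol

/-- Arithmetic of the union bound: at most `4 ^ q` inputs of Bob, `2 ^ (h + 1)` help strings, and a
factor 2 to bring the failure probability down to `1/2`. It is used with `a = 9 ^ l`, `b = 8 ^ l`.
-/
theorem two_mul_le_of_amplified {p q h a b n w : ℕ} (hpq : p ≤ 2 ^ q) (ha : 0 < a)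
    (h1 : a * n ≤ (2 ^ q * p) * (2 ^ (h + 1) * (b * w))) (h2 : 2 ^ (h + 2 * q + 2) * b ≤ a) :
    2 * n ≤ w := by
  refine Nat.le_of_mul_le_mul_left ?_ ha
  calc a * (2 * n) = 2 * (a * n) := by ring
    _ ≤ 2 * ((2 ^ q * 2 ^ q) * (2 ^ (h + 1) * (b * w))) := by
        refine Nat.mul_le_mul_left _ (h1.trans ?_)
        gcongr
    _ = (2 ^ (h + 2 * q + 2) * b) * w := by ring
    _ ≤ a * w := Nat.mul_le_mul_right _ h2

/-- Help cost versus verification cost for Equals-Index. -/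
theorem eqIdx_le_of_solves {p q : ℕ} (hpq : p ≤ 2 ^ q)
    {P : OMAProtocol (Fin p → Fin q → Bool) ((Fin q → Bool) × Fin p)}
    (hP : P.Solves (eqIdx p q)) :
    p * q ≤ 1 + 12 * (P.hcost + 2 * q + 2) * (P.vcost + 1) := by
  classical
  -- The 6 comes from `(9/8) ^ 6 > 2`: every six units of `l` halve the error.
  obtain ⟨l, hl⟩ : ∃ l, l = 6 * (P.hcost + 2 * q + 2) := ⟨_, rfl⟩
  let W := Fin (2 * l) → Fin P.coins → Bool
  let good : (Fin p → Fin q → Bool) → W → Prop := fun x w =>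
    ∀ y, P.amplifiedAccepts l w y (fun i => P.msg x (w i)) ↔ eqIdx p q x y = true
  have hW : Fintype.card W = (2 ^ P.coins) ^ (2 * l) := by simp [W]
  have hWpos : 0 < Fintype.card W := by rw [hW]; positivity
  have hbad : ∀ x, 2 * (Finset.univ.filter fun w => ¬ good x w).card ≤ Fintype.card W := by
    intro x
    set B : ((Fin q → Bool) × Fin p) → Finset W := fun y => Finset.univ.filter fun w =>
      ¬ (P.amplifiedAccepts l w y (fun i => P.msg x (w i)) ↔ eqIdx p q x y = true) with hBdef
    have hB : ∀ y, 9 ^ l * (B y).card ≤ 2 ^ (P.hcost + 1) * (8 ^ l * Fintype.card W) := by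
      intro y
      rw [hW]
      exact OMAProtocol.card_amplified_error_le hP l x y (B y) fun w hw => (Finset.mem_filter.1 hw).2
    have hsub : (Finset.univ.filter fun w => ¬ good x w) ⊆ Finset.univ.biUnion B := by
      intro w hw
      obtain ⟨y, hy⟩ := not_forall.1 (Finset.mem_filter.1 hw).2
      exact Finset.mem_biUnion.2 ⟨y, Finset.mem_univ _, Finset.mem_filter.2 ⟨Finset.mem_univ _, hy⟩⟩
    have h1 : 9 ^ l * (Finset.univ.filter fun w => ¬ good x w).card ≤
        (2 ^ q * p) * (2 ^ (P.hcost + 1) * (8 ^ l * Fintype.card W)) := by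
      calc _ ≤ 9 ^ l * ∑ y, (B y).card :=
            Nat.mul_le_mul_left _ ((Finset.card_le_card hsub).trans Finset.card_biUnion_le)
        _ = ∑ y, 9 ^ l * (B y).card := Finset.mul_sum _ _ _
        _ ≤ Finset.univ.card • _ := Finset.sum_le_card_nsmul _ _ _ fun y _ => hB y
        _ = _ := by simp
    have h2 : 2 ^ (P.hcost + 2 * q + 2) * 8 ^ l ≤ 9 ^ l := by
      rw [hl, pow_mul, pow_mul, ← mul_pow]
      exact Nat.pow_le_pow_left (by norm_num) _
    exact two_mul_le_of_amplified hpq (by positivity) h1 h2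
  -- some random string is good for half of Alice's inputs
  obtain ⟨w, hw⟩ : ∃ w : W, Fintype.card (Fin p → Fin q → Bool) ≤
      2 * (Finset.univ.filter fun x => good x w).card := by
    have hx : ∀ x, Fintype.card W ≤ 2 * (Finset.univ.filter fun w => good x w).card := by
      intro x
      have h1 : (Finset.univ.filter fun w => good x w).card +
          (Finset.univ.filter fun w => ¬ good x w).card = Fintype.card W := by
        rw [← Finset.card_univ]
        exact Finset.card_filter_add_card_filter_not _
      have h2 := hbad x
      omega
    have hdc : ∑ x, (Finset.univ.filter fun w => good x w).card =
        ∑ w, (Finset.univ.filter fun x => good x w).card := by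
      simp only [Finset.card_filter]
      exact Finset.sum_comm
    by_contra! hlt
    have : Nonempty W := Fintype.card_pos_iff.1 hWpos
    have h5 := Finset.sum_lt_sum_of_nonempty (s := (Finset.univ : Finset W))
      Finset.univ_nonempty fun w _ => hlt w
    have h6 := Finset.sum_le_sum (s := Finset.univ) fun x _ => hx x
    rw [← Finset.mul_sum] at h5 h6
    rw [hdc] at h6
    simp only [Finset.sum_const, Finset.card_univ, smul_eq_mul] at h5 h6
    rw [mul_comm] at h6
    omega
  -- With `w` fixed, the messages determine a good `x`: its `j`-th string is the only `y` that Bob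
  -- accepts at index `j`.
  have hinj : (Finset.univ.filter fun x => good x w).card ≤
      (Fintype.piFinset fun _ : Fin (2 * l) => boundedBitStrings P.vcost).card := by
    refine Finset.card_le_card_of_injOn (fun x i => P.msg x (w i)) ?_ ?_
    · intro x _
      exact Fintype.mem_piFinset.2 fun i => mem_boundedBitStrings (P.length_msg_le x (w i))
    · intro x hx x' hx' he
      have h1 := (Finset.mem_filter.1 hx).2
      have h2 := (Finset.mem_filter.1 hx').2
      funext j
      have h3 : eqIdx p q x (x j, j) = true := by simp [eqIdx]
      have h4 := (h1 (x j, j)).2 h3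
      simp only at he
      rw [he] at h4
      simpa [eqIdx] using (h2 (x j, j)).1 h4
  have hcount : 2 ^ (p * q) ≤ 2 ^ (1 + (P.vcost + 1) * (2 * l)) := by
    calc 2 ^ (p * q) = Fintype.card (Fin p → Fin q → Bool) := by
          simp [← pow_mul, mul_comm]
      _ ≤ _ := hw
      _ ≤ 2 * (boundedBitStrings P.vcost).card ^ (2 * l) := by
          refine Nat.mul_le_mul_left _ (hinj.trans_eq ?_)
          simp
      _ ≤ 2 * (2 ^ (P.vcost + 1)) ^ (2 * l) := by
          gcongr; exact card_boundedBitStrings_le _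
      _ = _ := by rw [← pow_mul, pow_add, pow_one]
  have := (Nat.pow_le_pow_iff_right (by norm_num)).1 hcount
  rw [hl] at this
  refine this.trans_eq ?_
  ring

/-! ### Bounds on the one-way complexity. -/

/-- A one-way protocol, as an online Merlin-Arthur protocol without help. -/
def OneWayProtocol.toOMA {X Y : Type} (P : OneWayProtocol X Y) : OMAProtocol X Y where
  coins := P.coins
  help _ _ := []
  msg := P.msg
  out y _ m _ := some (P.out y m)

theorem OneWayProtocol.Solves.toOMA {X Y : Type} {P : OneWayProtocol X Y} {f : X → Y → Bool}
    (hP : P.Solves f) : P.toOMA.Solves f := by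
  constructor
  · intro x y hf
    simpa [OneWayProtocol.toOMA, hf] using hP x y
  · intro x y hf H
    simpa [OneWayProtocol.toOMA, hf] using hP x y

theorem OneWayProtocol.hcost_toOMA {X Y : Type} [Fintype X] [Fintype Y]
    (P : OneWayProtocol X Y) : P.toOMA.hcost = 0 := by
  simp [OMAProtocol.hcost, OneWayProtocol.toOMA]

theorem le_oneWayComplexity_eqIdx {p q : ℕ} (hpq : p ≤ 2 ^ q) :
    p * q ≤ 1 + 12 * (2 * q + 2) * (oneWayComplexity (eqIdx p q) + 1) := by
  obtain ⟨P, hP, hc⟩ := exists_cost_eq_oneWayComplexity (eqIdx p q)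
  have h := eqIdx_le_of_solves hpq hP.toOMA
  have hv : P.toOMA.vcost = P.cost := rfl
  rwa [P.hcost_toOMA, hv, hc, zero_add] at h

/-- A fixed-length binary code for a finite type. -/
theorem exists_bitString_code (M : Type*) [Fintype M] (L : ℕ) (h : Fintype.card M ≤ 2 ^ L) :
    ∃ enc : M → List Bool, Function.Injective enc ∧ ∀ m, (enc m).length = L := by
  obtain ⟨e⟩ : Nonempty (M ↪ (Fin L → Bool)) :=
    Function.Embedding.nonempty_of_card_le (by simpa using h)
  exact ⟨fun m => List.ofFn (e m), fun a b hab => e.injective (List.ofFn_injective hab), by simp⟩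

/-- A one-way protocol with uniform seeds and messages from arbitrary finite types. -/
theorem oneWayComplexity_le {X Y S M : Type} [Fintype X] [Fintype S] [Fintype M] [Nonempty M]
    (f : X → Y → Bool) (r L : ℕ) (hS : Fintype.card S = 2 ^ r) (hM : Fintype.card M ≤ 2 ^ L)
    (msg : X → S → M) (out : Y → M → Bool)
    (h : ∀ x y, 3 * (Finset.univ.filter fun s => out y (msg x s) ≠ f x y).card ≤ Fintype.card S) :
    oneWayComplexity f ≤ L := by
  obtain ⟨enc, hinj, hlen⟩ := exists_bitString_code M L hM
  let e : (Fin r → Bool) ≃ S := Fintype.equivOfCardEq (by simp [hS])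
  let P : OneWayProtocol X Y :=
    { coins := r
      msg := fun x R => enc (msg x (e R))
      out := fun y m => out y (Function.invFun enc m) }
  have hP : P.Solves f := by
    intro x y
    simp only [P, Function.leftInverse_invFun hinj _]
    exact coinProb_comp_equiv_le_third e (fun s => out y (msg x s) ≠ f x y) (h x y)
  refine (show oneWayComplexity f ≤ P.cost from Nat.sInf_le ⟨P, hP, rfl⟩).trans ?_
  exact Finset.sup_le fun z _ => (hlen _).le

/-- A random parity vanishes at a nonzero vector with probability at most `1/2`. -/
theorem two_mul_card_dotProduct_eq_zero_le {ι : Type*} [Fintype ι] [DecidableEq ι] {z : ι → ZMod 2}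
    (hz : z ≠ 0) :
    2 * (Finset.univ.filter fun b : ι → ZMod 2 => b ⬝ᵥ z = 0).card ≤ 2 ^ Fintype.card ι := by
  obtain ⟨i, hi⟩ := Function.ne_iff.1 hz
  have h1 : (Finset.univ.filter fun b : ι → ZMod 2 => b ⬝ᵥ z = 0).card ≤
      (Finset.univ.filter fun b : ι → ZMod 2 => ¬ b ⬝ᵥ z = 0).card := by
    -- Flipping coordinate `i`, where `z i ≠ 0`, changes the parity.
    refine Finset.card_le_card_of_injOn (fun b => b + Pi.single i 1) ?_ ?_
    · intro b hb
      have hb' := (Finset.mem_filter.1 hb).2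
      refine Finset.mem_coe.2 (Finset.mem_filter.2 ⟨Finset.mem_univ _, ?_⟩)
      simpa [add_dotProduct, hb'] using hi
    · intro b _ b' _ h
      exact add_right_cancel h
  have h2 : (Finset.univ.filter fun b : ι → ZMod 2 => b ⬝ᵥ z = 0).card +
      (Finset.univ.filter fun b : ι → ZMod 2 => ¬ b ⬝ᵥ z = 0).card = 2 ^ Fintype.card ι := by
    rw [Finset.card_filter_add_card_filter_not]
    simp [ZMod.card]
  omega

/-- Two random parities. -/
def parityPair {ι : Type*} [Fintype ι] (b : (ι → ZMod 2) × (ι → ZMod 2)) (z : ι → ZMod 2) :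
    ZMod 2 × ZMod 2 :=
  (b.1 ⬝ᵥ z, b.2 ⬝ᵥ z)

/-- The two parities are independent, so the colliding pairs form the square of a set of density at
most `1/2`. -/
theorem four_mul_card_parityPair_eq_le {ι : Type*} [Fintype ι] [DecidableEq ι]
    {z z' : ι → ZMod 2} (hz : z ≠ z') :
    4 * (Finset.univ.filter fun b : (ι → ZMod 2) × (ι → ZMod 2) =>
      parityPair b z = parityPair b z').card ≤ 4 ^ Fintype.card ι := by
  have h := two_mul_card_dotProduct_eq_zero_le (sub_ne_zero.2 hz)
  have h1 : (Finset.univ.filter fun b : (ι → ZMod 2) × (ι → ZMod 2) =>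
      parityPair b z = parityPair b z') =
      (Finset.univ.filter fun b : ι → ZMod 2 => b ⬝ᵥ (z - z') = 0) ×ˢ
      (Finset.univ.filter fun b : ι → ZMod 2 => b ⬝ᵥ (z - z') = 0) := by
    ext b
    simp [parityPair, dotProduct_sub, sub_eq_zero]
  rw [h1, Finset.card_product]
  calc _ = (2 * (Finset.univ.filter fun b : ι → ZMod 2 => b ⬝ᵥ (z - z') = 0).card) *
        (2 * (Finset.univ.filter fun b : ι → ZMod 2 => b ⬝ᵥ (z - z') = 0).card) := by ring
    _ ≤ 2 ^ Fintype.card ι * 2 ^ Fintype.card ι := Nat.mul_le_mul h h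
    _ = _ := by rw [← mul_pow]; norm_num

/-- The polynomial with the bits of `x` as its coefficients. -/
noncomputable def bitPolynomial (F : Type*) [Semiring F] {q : ℕ} (x : Fin q → Bool) :
    Polynomial F :=
  ∑ i : Fin q, Polynomial.monomial (i : ℕ) (if x i then 1 else 0)

theorem coeff_bitPolynomial (F : Type*) [Semiring F] {q : ℕ} (x : Fin q → Bool) (i : Fin q) :
    (bitPolynomial F x).coeff i = if x i then 1 else 0 := by
  simp [bitPolynomial, Polynomial.coeff_monomial, Fin.val_inj]

theorem bitPolynomial_injective (F : Type*) [Semiring F] [Nontrivial F] (q : ℕ) :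
    Function.Injective (bitPolynomial F (q := q)) := by
  intro x y h
  funext i
  have := congrArg (fun P => P.coeff (i : ℕ)) h
  simp only [coeff_bitPolynomial] at this
  cases hx : x i <;> cases hy : y i <;> simp_all

theorem natDegree_bitPolynomial_le (F : Type*) [Semiring F] {q : ℕ} (x : Fin q → Bool) :
    (bitPolynomial F x).natDegree ≤ q :=
  Polynomial.natDegree_sum_le_of_forall_le _ _ fun i _ =>
    (Polynomial.natDegree_monomial_le _).trans i.2.le

theorem card_eval_bitPolynomial_eq_le {F : Type*} [Field F] [Fintype F] [DecidableEq F] {q : ℕ}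
    {x y : Fin q → Bool} (h : x ≠ y) :
    (Finset.univ.filter fun a : F =>
      (bitPolynomial F x).eval a = (bitPolynomial F y).eval a).card ≤ q := by
  have hne : bitPolynomial F x - bitPolynomial F y ≠ 0 :=
    sub_ne_zero.2 ((bitPolynomial_injective F q).ne h)
  refine (Polynomial.card_le_degree_of_subset_roots (p := bitPolynomial F x - bitPolynomial F y)
    ?_).trans ((Polynomial.natDegree_sub_le _ _).trans
      (max_le (natDegree_bitPolynomial_le F x) (natDegree_bitPolynomial_le F y)))
  intro a ha
  have := (Finset.mem_filter.1 (show a ∈ Finset.univ.filter _ from ha)).2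
  rw [Polynomial.mem_roots hne, Polynomial.IsRoot, Polynomial.eval_sub, this, sub_self]

/-- Polynomial evaluation followed by two parities is a two-bit hash with collision probability at
most `1/3`. -/
theorem card_hash_collision_le {F : Type*} [Field F] [Fintype F] {m q : ℕ}
    (hF : Fintype.card F = 2 ^ m) (hq : 12 * q ≤ 2 ^ m) (e : F ≃ (Fin m → ZMod 2))
    {x y : Fin q → Bool} (h : x ≠ y) :
    3 * (Finset.univ.filter fun s : F × ((Fin m → ZMod 2) × (Fin m → ZMod 2)) =>
      parityPair s.2 (e ((bitPolynomial F x).eval s.1)) =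
        parityPair s.2 (e ((bitPolynomial F y).eval s.1))).card ≤ 2 ^ m * 4 ^ m := by
  classical
  set Z := Finset.univ.filter fun a : F =>
    (bitPolynomial F x).eval a = (bitPolynomial F y).eval a with hZ
  have hZq : Z.card ≤ q := card_eval_bitPolynomial_eq_le h
  rw [Finset.card_filter, Fintype.sum_prod_type]
  -- Off `Z` the parities collide with probability at most `1/4`, and `Z` has density at most
  -- `1/12`; the sum is `1/3`.
  have h1 : ∀ a : F, 4 * (∑ b : (Fin m → ZMod 2) × (Fin m → ZMod 2),
      if parityPair b (e ((bitPolynomial F x).eval a)) =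
        parityPair b (e ((bitPolynomial F y).eval a)) then 1 else 0) ≤
      4 ^ m + 4 * 4 ^ m * (if a ∈ Z then 1 else 0) := by
    intro a
    rw [← Finset.card_filter]
    by_cases ha : a ∈ Z
    · have : (Finset.univ : Finset ((Fin m → ZMod 2) × (Fin m → ZMod 2))).card = 4 ^ m := by
        rw [Finset.card_univ, Fintype.card_prod]
        simp [ZMod.card, ← mul_pow]
      have h2 := Finset.card_filter_le Finset.univ
        fun b : (Fin m → ZMod 2) × (Fin m → ZMod 2) =>
          parityPair b (e ((bitPolynomial F x).eval a)) =
            parityPair b (e ((bitPolynomial F y).eval a))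
      rw [if_pos ha]
      omega
    · have hne : (bitPolynomial F x).eval a ≠ (bitPolynomial F y).eval a := by
        simpa [hZ] using ha
      have := four_mul_card_parityPair_eq_le (e.injective.ne hne)
      simpa [ha] using this
  have h2 := Finset.sum_le_sum (s := Finset.univ) fun a _ => h1 a
  rw [← Finset.mul_sum, Finset.sum_add_distrib, ← Finset.mul_sum, Finset.sum_const,
    Finset.card_univ, hF, ← Finset.card_filter, smul_eq_mul] at h2
  have h3 : (Finset.univ.filter fun a => a ∈ Z).card ≤ q := by simpa using hZq
  have h4 : 4 * 4 ^ m * (Finset.univ.filter fun a => a ∈ Z).card ≤ 4 * 4 ^ m * q :=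
    Nat.mul_le_mul_left _ h3
  have h5 : 4 ^ m * (12 * q) ≤ 4 ^ m * 2 ^ m := Nat.mul_le_mul_left _ hq
  nlinarith

/-- Coins are private, so Alice sends the `3 * m`-bit seed, but one seed serves all `p` strings: Bob
checks only one hash, so no union bound over indices is needed. -/
theorem oneWayComplexity_eqIdx_le (p q m : ℕ) (hm : m ≠ 0) (hq : 12 * q ≤ 2 ^ m) :
    oneWayComplexity (eqIdx p q) ≤ 3 * m + 2 * p := by
  classical
  let F := GaloisField 2 m
  have : Fintype F := Fintype.ofFinite F
  have hF : Fintype.card F = 2 ^ m := by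
    rw [← Nat.card_eq_fintype_card]; exact GaloisField.card 2 m hm
  let e : F ≃ (Fin m → ZMod 2) := Fintype.equivOfCardEq (by simp [hF, ZMod.card])
  let hash : F × ((Fin m → ZMod 2) × (Fin m → ZMod 2)) → (Fin q → Bool) → ZMod 2 × ZMod 2 :=
    fun s z => parityPair s.2 (e ((bitPolynomial F z).eval s.1))
  have hS : Fintype.card (F × ((Fin m → ZMod 2) × (Fin m → ZMod 2))) = 2 ^ (3 * m) := by
    rw [Fintype.card_prod, Fintype.card_prod, hF]
    simp [ZMod.card]
    ring
  refine oneWayComplexity_le (S := F × ((Fin m → ZMod 2) × (Fin m → ZMod 2)))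
    (M := (F × ((Fin m → ZMod 2) × (Fin m → ZMod 2))) × (Fin p → ZMod 2 × ZMod 2))
    (eqIdx p q) (3 * m) (3 * m + 2 * p) hS ?_
    (fun x s => (s, fun j => hash s (x j))) (fun y n => decide (hash n.1 y.1 = n.2 y.2)) ?_
  · rw [Fintype.card_prod, hS]
    simp [pow_add, pow_mul]
  · intro x y
    by_cases hxy : y.1 = x y.2
    · simp [eqIdx, hxy]
    · have := card_hash_collision_le hF hq e hxy
      rw [hS]
      simp only [eqIdx, hxy, decide_false, ne_eq, decide_eq_false_iff_not, not_not]
      refine this.trans_eq ?_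
      rw [pow_mul, ← mul_pow]; norm_num

/-! ### A non-trivial protocol. -/

/-- Merlin can send all of Alice's input, to be checked against two random parities of it. -/
theorem exists_solves_vcost_le_two (p q : ℕ) :
    ∃ P : OMAProtocol (Fin p → Fin q → Bool) ((Fin q → Bool) × Fin p),
      P.Solves (eqIdx p q) ∧ P.vcost ≤ 2 := by
  classical
  obtain ⟨encX, hX, -⟩ := exists_bitString_code (Fin p → Fin q → Bool) (q * p)
    (by simp [pow_mul])
  obtain ⟨enc, hinj, hlen⟩ := exists_bitString_code (ZMod 2 × ZMod 2) 2 (by simp)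
  let v : (Fin p → Fin q → Bool) → Fin p × Fin q → ZMod 2 := fun x i => if x i.1 i.2 then 1 else 0
  have hv : Function.Injective v := by
    intro x y h
    funext i j
    have := congrFun h (i, j)
    simp only [v] at this
    cases hx : x i j <;> cases hy : y i j <;> simp_all
  let e : (Fin (2 * (p * q)) → Bool) ≃ (Fin p × Fin q → ZMod 2) × (Fin p × Fin q → ZMod 2) :=
    Fintype.equivOfCardEq (by simp [ZMod.card]; ring)
  let P : OMAProtocol (Fin p → Fin q → Bool) ((Fin q → Bool) × Fin p) :=
    { coins := 2 * (p * q)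
      help := fun x _ => encX x
      msg := fun x R => enc (parityPair (e R) (v x))
      -- Bob sees `R`, so the parities' seed costs nothing. A help string outside the range of
      -- `encX` decodes to an arbitrary input, which is harmless: it is checked like any other
      -- claim.
      out := fun y H a R => some (decide
        (parityPair (e R) (v (Function.invFun encX H)) = Function.invFun enc a ∧
          eqIdx p q (Function.invFun encX H) y = true)) }
  refine ⟨P, ⟨?_, ?_⟩, ?_⟩
  · intro x y hf
    simp [P, Function.leftInverse_invFun hinj _, Function.leftInverse_invFun hX _, hf, coinProb]
  · intro x y hf H
    simp only [P, Function.leftInverse_invFun hinj _, Option.some.injEq, decide_eq_true_eq]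
    set x' := Function.invFun encX H
    refine coinProb_comp_equiv_le_third e
      (fun s => parityPair s (v x') = parityPair s (v x) ∧ eqIdx p q x' y = true) ?_
    by_cases hx : x' = x
    · simp [hx, hf]
    · have h1 := four_mul_card_parityPair_eq_le (hv.ne hx)
      have h2 : Fintype.card ((Fin p × Fin q → ZMod 2) × (Fin p × Fin q → ZMod 2)) =
          4 ^ Fintype.card (Fin p × Fin q) := by
        rw [Fintype.card_prod]; simp [ZMod.card, ← mul_pow]
      rw [h2]
      have h3 := Finset.card_le_card (Finset.monotone_filter_right Finset.univ
        (p := fun s => parityPair s (v x') = parityPair s (v x) ∧ eqIdx p q x' y = true)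
        (q := fun s => parityPair s (v x') = parityPair s (v x)) fun s _ hs => hs.1)
      omega
  · exact Finset.sup_le fun z _ => (hlen _).le

/-! ### Linear bounds and asymptotics. -/

theorem floor_div_mul_floor_le (N : ℕ) (c : ℝ) : ⌊(N : ℝ) / c⌋₊ * ⌊c⌋₊ ≤ N := by
  rcases le_or_gt c 0 with hc | hc
  · simp [Nat.floor_of_nonpos hc]
  · have h1 := Nat.floor_le (div_nonneg (Nat.cast_nonneg N) hc.le : 0 ≤ (N : ℝ) / c)
    have h2 := Nat.floor_le hc.le
    have h3 : ((⌊(N : ℝ) / c⌋₊ * ⌊c⌋₊ : ℕ) : ℝ) ≤ N := by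
      push_cast
      calc (⌊(N : ℝ) / c⌋₊ : ℝ) * ⌊c⌋₊ ≤ (N : ℝ) / c * c := by gcongr
        _ = N := div_mul_cancel₀ _ hc.ne'
    exact_mod_cast h3

theorem oneWayComplexity_eqIdx_le_linear {p q N : ℕ} (hp : 1 ≤ p) (hN : Nat.log 2 N ≤ p)
    (hq : q ≤ N) : oneWayComplexity (eqIdx p q) ≤ 20 * p := by
  have h1 : q < 2 ^ (Nat.log 2 q + 1) := Nat.lt_pow_succ_log_self (by norm_num) q
  have h2 : 12 * q ≤ 2 ^ (Nat.log 2 q + 5) := by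
    rw [show Nat.log 2 q + 5 = Nat.log 2 q + 1 + 4 by ring, pow_add]
    omega
  have h3 := oneWayComplexity_eqIdx_le p q _ (by omega) h2
  have h4 : Nat.log 2 q ≤ Nat.log 2 N := Nat.log_mono_right hq
  omega

/-- This makes `R` tend to infinity with `p`, so that constant verification cost is non-trivial. -/
theorem le_oneWayComplexity_eqIdx_linear {p q : ℕ} (hq : 1 ≤ q) (hpq : p ≤ q) :
    p ≤ 49 + 48 * oneWayComplexity (eqIdx p q) := by
  have h := le_oneWayComplexity_eqIdx (hpq.trans Nat.lt_two_pow_self.le)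
  have : q * p ≤ q * (49 + 48 * oneWayComplexity (eqIdx p q)) := by nlinarith
  exact Nat.le_of_mul_le_mul_left this hq

/-- A verification cost that is a small fraction of `p` forces a help cost that is a large multiple
of `q`. -/
theorem le_mul_hcost {p q : ℕ} (hp : 1 ≤ p) (hpq : p ≤ q) (hq : 8 ≤ q)
    {P : OMAProtocol (Fin p → Fin q → Bool) ((Fin q → Bool) × Fin p)} (hP : P.Solves (eqIdx p q))
    {ε : ℝ} (hε : ε ≤ 1 / 96) (hv : (P.vcost : ℝ) + 1 ≤ ε * p) :
    (q : ℝ) ≤ 24 * ε * P.hcost := by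
  have h := eqIdx_le_of_solves (hpq.trans Nat.lt_two_pow_self.le) hP
  have h' : (p : ℝ) * q ≤ 1 + 12 * (P.hcost + 2 * q + 2) * (P.vcost + 1) := by exact_mod_cast h
  have hp' : (1 : ℝ) ≤ p := by exact_mod_cast hp
  have hq' : (8 : ℝ) ≤ q := by exact_mod_cast hq
  have h1 : (p : ℝ) * q ≤ p * (1 + 12 * (P.hcost + 2 * q + 2) * ε) := by
    calc (p : ℝ) * q ≤ 1 + 12 * (P.hcost + 2 * q + 2) * (P.vcost + 1) := h'
      _ ≤ p + 12 * (P.hcost + 2 * q + 2) * (ε * p) := by gcongr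
      _ = _ := by ring
  have h2 := le_of_mul_le_mul_left h1 (by linarith)
  -- For `ε ≤ 1/96` the term `12 * ε * (2 * q + 2)` is at most `(q + 1) / 4`, so for `q ≥ 8` at
  -- least `q / 2` is left for the help term.
  nlinarith [mul_le_mul_of_nonneg_right hε (by linarith : (0 : ℝ) ≤ 2 * q + 2)]

theorem tendsto_logb_two_natCast : Tendsto (fun N : ℕ => Real.logb 2 (N : ℝ)) atTop atTop :=
  (Real.tendsto_logb_atTop (by norm_num)).comp tendsto_natCast_atTop_atTop

theorem corollary3 (C : ℕ → ℝ)
    (hC : ∀ᶠ N : ℕ in atTop, √(N : ℝ) ≤ C N ∧ C N ≤ (N : ℝ) / Real.logb 2 (N : ℝ)) :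
    NontrivialOMAComplexityIsOmega (fun N => eqIdx ⌊(N : ℝ) / C N⌋₊ ⌊C N⌋₊) C ∧
    (∀ N : ℕ, ⌊(N : ℝ) / C N⌋₊ * ⌊C N⌋₊ ≤ N) ∧
    (fun N : ℕ => ((⌊(N : ℝ) / C N⌋₊ * ⌊C N⌋₊ : ℕ) : ℝ)) ~[atTop] (fun N : ℕ => (N : ℝ)) := by
  have hCpos : ∀ᶠ N : ℕ in atTop, 0 < C N := by
    filter_upwards [hC, eventually_gt_atTop 0] with N h hN
    exact (Real.sqrt_pos.2 (Nat.cast_pos.2 hN)).trans_le h.1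
  have hCtop : Tendsto C atTop atTop :=
    tendsto_atTop_mono' _ (hC.mono fun N h => h.1)
      (Real.tendsto_sqrt_atTop.comp tendsto_natCast_atTop_atTop)
  -- The upper bound on `C` is what lets `p` absorb the hash seed.
  have hlog : ∀ᶠ N : ℕ in atTop, Real.logb 2 (N : ℝ) ≤ (N : ℝ) / C N := by
    filter_upwards [hC, hCpos, tendsto_logb_two_natCast.eventually_gt_atTop 0] with N h h0 hl
    rw [le_div_iff₀ h0, mul_comm, ← le_div_iff₀ hl]
    exact h.2
  have hDtop : Tendsto (fun N : ℕ => (N : ℝ) / C N) atTop atTop :=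
    tendsto_atTop_mono' _ hlog tendsto_logb_two_natCast
  have hp : Tendsto (fun N : ℕ => ⌊(N : ℝ) / C N⌋₊) atTop atTop :=
    tendsto_nat_floor_atTop.comp hDtop
  have hq : Tendsto (fun N : ℕ => ⌊C N⌋₊) atTop atTop := tendsto_nat_floor_atTop.comp hCtop
  -- The lower bound on `C` gives `p ≤ q`, hence the `p ≤ 2 ^ q` of the trade-off.
  have hpq : ∀ᶠ N : ℕ in atTop, ⌊(N : ℝ) / C N⌋₊ ≤ ⌊C N⌋₊ := by
    filter_upwards [hC, hCpos] with N h h0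
    refine Nat.floor_le_floor ?_
    rw [div_le_iff₀ h0]
    calc (N : ℝ) = √N * √N := (Real.mul_self_sqrt (Nat.cast_nonneg N)).symm
      _ ≤ C N * C N := by gcongr <;> exact h.1
  refine ⟨⟨?_, ?_⟩, fun N => floor_div_mul_floor_le N (C N), ?_⟩
  · choose P hP hv using fun N : ℕ => exists_solves_vcost_le_two ⌊(N : ℝ) / C N⌋₊ ⌊C N⌋₊
    refine ⟨P, hP, ?_⟩
    have hR : Tendsto (fun N : ℕ =>
        (oneWayComplexity (eqIdx ⌊(N : ℝ) / C N⌋₊ ⌊C N⌋₊) : ℝ)) atTop atTop := by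
      refine tendsto_natCast_atTop_atTop.comp (tendsto_atTop.2 fun b => ?_)
      filter_upwards [hpq, hq.eventually_ge_atTop 1,
        hp.eventually_ge_atTop (49 + 48 * b)] with N h1 h2 h3
      have := le_oneWayComplexity_eqIdx_linear h2 h1
      omega
    have hO : (fun N => ((P N).vcost : ℝ)) =O[atTop] fun _ => (1 : ℝ) := by
      refine IsBigO.of_bound 2 (Eventually.of_forall fun N => ?_)
      have : ((P N).vcost : ℝ) ≤ 2 := by exact_mod_cast hv N
      simpa using this
    refine hO.trans_isLittleO ?_
    rw [isLittleO_const_left]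
    exact Or.inr (tendsto_norm_atTop_atTop.comp hR)
  · rintro P ⟨hP, hv⟩
    have hvp : (fun N => ((P N).vcost : ℝ) + 1) =o[atTop]
        fun N : ℕ => (⌊(N : ℝ) / C N⌋₊ : ℝ) := by
      refine (hv.trans_isBigO (IsBigO.of_bound 20 ?_)).add ?_
      · filter_upwards [hp.eventually_ge_atTop 1, hlog, hC, hCpos,
          eventually_ge_atTop 2, tendsto_logb_two_natCast.eventually_ge_atTop 1] with
          N h1 h2 h3 h4 h5 h6
        have hlogp : Nat.log 2 N ≤ ⌊(N : ℝ) / C N⌋₊ := by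
          rw [← Real.natFloor_logb_natCast]
          exact Nat.floor_le_floor (by exact_mod_cast h2)
        have hqN : ⌊C N⌋₊ ≤ N := by
          refine Nat.floor_le_of_le (h3.2.trans (div_le_self (Nat.cast_nonneg N) h6))
        have := oneWayComplexity_eqIdx_le_linear h1 hlogp hqN
        simp only [Real.norm_natCast]
        exact_mod_cast this
      · rw [isLittleO_const_left]
        exact Or.inr (tendsto_norm_atTop_atTop.comp (tendsto_natCast_atTop_atTop.comp hp))
    rw [isLittleO_iff]
    intro c hc
    -- `48 = 2 * 24`: the 2 from `C N ≤ 2 * ⌊C N⌋₊`, the 24 from `le_mul_hcost`, which also needs `1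
    -- / 96`.
    have hε : 0 < min (1 / 96) (c / 48) := lt_min (by norm_num) (by positivity)
    filter_upwards [isLittleO_iff.1 hvp hε, hp.eventually_ge_atTop 1, hpq,
      hq.eventually_ge_atTop 8, hCpos] with N h1 h2 h3 h4 h5
    rw [Real.norm_of_nonneg (by positivity), Real.norm_natCast] at h1
    have h6 := le_mul_hcost h2 h3 h4 (hP N) (min_le_left _ _) h1
    have h7 : C N < ⌊C N⌋₊ + 1 := Nat.lt_floor_add_one _
    have h8 : (8 : ℝ) ≤ ⌊C N⌋₊ := by exact_mod_cast h4
    rw [Real.norm_of_nonneg h5.le, Real.norm_natCast]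
    calc C N ≤ 2 * ⌊C N⌋₊ := by linarith
      _ ≤ 2 * (24 * (c / 48) * (P N).hcost) := by
          gcongr
          exact h6.trans (by gcongr; exact min_le_right _ _)
      _ = c * (P N).hcost := by ring
      _ ≤ c * (P N).tcost := by
          gcongr
          exact Nat.le_add_right _ _
  · have h1 := (isEquivalent_nat_floor (R := ℝ)).comp_tendsto hDtop
    have h2 := (isEquivalent_nat_floor (R := ℝ)).comp_tendsto hCtop
    refine ((h1.mul h2).congr_left ?_).congr_right ?_
    · exact Eventually.of_forall fun N => by simp
    · filter_upwards [hCpos] with N h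
      simp [div_mul_cancel₀ _ h.ne']
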